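/- For $n\ge 0$, a $B_n$-partition is a partition $\pi$ of the set $\{1,2,\dots,n,-1,-2,\dots,-n\}$ such that for every block $B$ of $\pi$ the set $-B=\{-b : b\in B\}$ is also a block of $\pi$, and such that at most one block $B$, called the zero-block, satisfies $B=-B$. A block pair of $\pi$ is an unordered pair $\{B,-B\}$, where $B$ is a block of $\pi$ with $B\neq -B$. Let $\xi_n'$ be the number of block pairs of a $B_n$-partition chosen uniformly at random among all $B_n$-partitions that have no zero-block, and let $E(\xi_n')$ and $V(\xi_n')$ be its expectation and variance. **Theorem.** The limiting distribution of $\xi_n'$ is normal: as $n\to\infty$, the random variable $$\frac{\xi_n'-E(\xi_n')}{\sqrt{V(\xi_n')}}$$ converges in distribution to the standard normal distribution $N(0,1)$. (The quotient is read as $0$ for the finitely many $n$ with $V(\xi_n')=0$.) -/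

import Mathlib

open MeasureTheory ProbabilityTheory Filter
open scoped Pointwise

/-- The set `{1, …, n, -1, …, -n}`. -/
noncomputable def signedSet (n : ℕ) : Finset ℤ := (Finset.Icc (-(n : ℤ)) n).erase 0

/-- A block `B` is a zero-block if `B = -B`, where `-B = {-b | b ∈ B}`. -/
def IsZeroBlock (B : Finset ℤ) : Prop := B = -B

instance (B : Finset ℤ) : Decidable (IsZeroBlock B) :=
  inferInstanceAs (Decidable (B = -B))

/-- A partition of `{±1, …, ±n}` is of type `B_n` if the negative of each block is a block and
there is at most one zero-block. -/
structure IsTypeB {n : ℕ} (π : Finpartition (signedSet n)) : Prop where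
  neg_mem : ∀ B ∈ π.parts, -B ∈ π.parts
  zeroBlock_unique : ∀ B ∈ π.parts, ∀ C ∈ π.parts, IsZeroBlock B → IsZeroBlock C → B = C

/-- The set of `B_n`-partitions without zero-block. -/
def BPartitionNoZero (n : ℕ) : Type :=
  {π : Finpartition (signedSet n) // IsTypeB π ∧ ∀ B ∈ π.parts, ¬ IsZeroBlock B}

/-- The set of block pairs of a partition: the unordered pairs `{B, -B}` where `B` is a block that
is not a zero-block. -/
def blockPairs {n : ℕ} (π : Finpartition (signedSet n)) : Finset (Sym2 (Finset ℤ)) :=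
  (π.parts.filter fun B => ¬ IsZeroBlock B).image fun B => s(B, -B)

instance (n : ℕ) : Finite (BPartitionNoZero n) :=
  inferInstanceAs (Finite {π : Finpartition (signedSet n) //
    IsTypeB π ∧ ∀ B ∈ π.parts, ¬ IsZeroBlock B})

/-- The partition of `{±1, …, ±n}` into singletons is a `B_n`-partition without zero-block. -/
instance (n : ℕ) : Nonempty (BPartitionNoZero n) := by
  have h : ∀ B ∈ (⊥ : Finpartition (signedSet n)).parts, ¬ IsZeroBlock B := by
    intro B hB hz
    obtain ⟨a, ha, rfl⟩ := Finpartition.mem_bot_iff.1 hB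
    have h0 : a ≠ 0 := (Finset.mem_erase.1 ha).1
    have h1 : ({a} : Finset ℤ) = {-a} := by simpa [IsZeroBlock] using hz
    have h2 : a = -a := Finset.singleton_injective h1
    omega
  refine ⟨⟨⊥, ⟨?_, fun B hB _ _ hz _ => absurd hz (h B hB)⟩, h⟩⟩
  intro B hB
  obtain ⟨a, ha, rfl⟩ := Finpartition.mem_bot_iff.1 hB
  refine Finpartition.mem_bot_iff.2 ⟨-a, ?_, by simp⟩
  simp only [signedSet, Finset.mem_erase, Finset.mem_Icc] at ha ⊢
  omega

/-- Every set of `B_n`-partitions without zero-block is an event. -/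
instance (n : ℕ) : MeasurableSpace (BPartitionNoZero n) := ⊤

instance (n : ℕ) : DiscreteMeasurableSpace (BPartitionNoZero n) :=
  ⟨fun _ => trivial⟩

/-- The uniform distribution on the `B_n`-partitions without zero-block. -/
noncomputable def unifBPartitionNoZero (n : ℕ) : Measure (BPartitionNoZero n) :=
  uniformOn Set.univ

instance (n : ℕ) : IsProbabilityMeasure (unifBPartitionNoZero n) :=
  inferInstanceAs (IsProbabilityMeasure (uniformOn (Set.univ : Set (BPartitionNoZero n))))

/-- The random variable `ξ'_n`: the number of block pairs of a `B_n`-partition without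
zero-block. -/
def numBlockPairs (n : ℕ) (π : BPartitionNoZero n) : ℝ := (blockPairs π.1).card

/-! The proof is Harper's method. Write A_n(x) for the sum of x^(number of block pairs) over the
partitions without zero-block. Deleting ±(n+1) gives A_{n+1} = x(A_n + 2A_n'). The operator p ↦ p +
2p' preserves real-rootedness, and positive numbers are never roots, so A_n / A_n(1) is a product of
factors (1-p) + pX with 0 ≤ p ≤ 1. Thus ξ'_n has the law of a sum of independent Bernoulli variables
(`exists_bernoulli_numBlockPairs`), and it remains to show that its variance V tends to infinity.

With A_n now denoting A_n(1), the same recurrence gives 4V + 2 = A_{n+2}/A_n - (A_{n+1}/A_n)^2. The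
Dobiński-type formula e^(1/2) A_n = Σ_j (2j)^n (1/2)^j / j! identifies the right side as the
variance of 2J, where J has weights proportional to the terms of the series. No single term carries
a large share of the sum (`mul_dobinskiTerm_le`), so J is not concentrated on a bounded window and
its variance is unbounded (`le_variance_numBlockPairs`).

Finally, each centered Bernoulli characteristic function is compared with a Gaussian one, with error
proportional to p(1-p). The errors add up to at most 2|t|^3/√V, which tends to 0. -/

/-! ### Inserting and deleting ±(n+1) in a block set. -/

/-- `P` is the set of blocks of a `B_n`-partition without zero-block. -/
structure IsNoZeroFamily (n : ℕ) (P : Finset (Finset ℤ)) : Prop where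
  empty_notMem : ∅ ∉ P
  exists_mem_iff : ∀ x : ℤ, (∃ B ∈ P, x ∈ B) ↔ x ≠ 0 ∧ |x| ≤ n
  eq_of_mem : ∀ B ∈ P, ∀ C ∈ P, ∀ x, x ∈ B → x ∈ C → B = C
  neg_mem : ∀ B ∈ P, -B ∈ P
  ne_neg : ∀ B ∈ P, B ≠ -B

theorem mem_signedSet {n : ℕ} {x : ℤ} : x ∈ signedSet n ↔ x ≠ 0 ∧ |x| ≤ n := by
  simp [signedSet, abs_le]

open Classical in
/-- The block sets of the `B_n`-partitions without zero-block. -/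
noncomputable def noZeroFamilies (n : ℕ) : Finset (Finset (Finset ℤ)) :=
  (signedSet n).powerset.powerset.filter (IsNoZeroFamily n)

theorem mem_noZeroFamilies {n : ℕ} {P : Finset (Finset ℤ)} :
    P ∈ noZeroFamilies n ↔ IsNoZeroFamily n P := by
  simp only [noZeroFamilies, Finset.mem_filter, Finset.mem_powerset, and_iff_right_iff_imp]
  intro h B hB
  rw [Finset.mem_powerset]
  intro x hx
  exact mem_signedSet.2 ((h.exists_mem_iff x).1 ⟨B, hB, hx⟩)

/-- Add `n + 1` to the block `B` and `-(n + 1)` to the block `-B`; for `B = ∅` this adds two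
singleton blocks. -/
noncomputable def extendFamily (n : ℕ) (P : Finset (Finset ℤ)) (B : Finset ℤ) :
    Finset (Finset ℤ) :=
  insert (insert (n + 1 : ℤ) B)
    (insert (insert (-(n + 1) : ℤ) (-B)) ((P.erase B).erase (-B)))

theorem mem_extendFamily {n : ℕ} {P : Finset (Finset ℤ)} {B C : Finset ℤ} :
    C ∈ extendFamily n P B ↔ C = insert (n + 1 : ℤ) B ∨ C = insert (-(n + 1) : ℤ) (-B) ∨
      (C ≠ -B ∧ C ≠ B ∧ C ∈ P) := by
  simp [extendFamily]

theorem Finset.neg_insert_int (a : ℤ) (B : Finset ℤ) : -(insert a B) = insert (-a) (-B) := by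
  ext x; simp [Finset.mem_neg']

namespace IsNoZeroFamily

variable {n : ℕ} {P : Finset (Finset ℤ)} {B C : Finset ℤ}

theorem abs_le (h : IsNoZeroFamily n P) (hB : B ∈ insert ∅ P) {x : ℤ} (hx : x ∈ B) :
    x ≠ 0 ∧ |x| ≤ n := by
  rcases Finset.mem_insert.1 hB with rfl | hB
  · simp at hx
  · exact (h.exists_mem_iff x).1 ⟨B, hB, hx⟩

theorem neg_mem_insert (h : IsNoZeroFamily n P) (hB : B ∈ insert ∅ P) : -B ∈ insert ∅ P := by
  rcases Finset.mem_insert.1 hB with rfl | hB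
  · simp
  · exact Finset.mem_insert_of_mem (h.neg_mem B hB)

theorem succ_notMem (h : IsNoZeroFamily n P) (hB : B ∈ insert ∅ P) : (n + 1 : ℤ) ∉ B := by
  intro hx
  have := (h.abs_le hB hx).2
  rw [_root_.abs_le] at this
  omega

theorem neg_succ_notMem (h : IsNoZeroFamily n P) (hB : B ∈ insert ∅ P) : (-(n + 1) : ℤ) ∉ B := by
  intro hx
  have := (h.abs_le hB hx).2
  rw [_root_.abs_le] at this
  omega

theorem neg_notMem (h : IsNoZeroFamily n P) (hB : B ∈ P) {x : ℤ} (hx : x ∈ B) : -x ∉ B := by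
  intro hx'
  exact h.ne_neg B hB (h.eq_of_mem B hB (-B) (h.neg_mem B hB) x hx (by simpa [Finset.mem_neg'] using hx'))

theorem extendFamily (h : IsNoZeroFamily n P) (hB : B ∈ insert ∅ P) :
    IsNoZeroFamily (n + 1) (extendFamily n P B) where
  empty_notMem := by
    have := h.empty_notMem
    rw [mem_extendFamily]
    rintro (h1 | h1 | h1)
    · exact Finset.insert_ne_empty _ _ h1.symm
    · exact Finset.insert_ne_empty _ _ h1.symm
    · exact this h1.2.2
  exists_mem_iff x := by
    have hx0 : (x ≠ 0 ∧ |x| ≤ ((n + 1 : ℕ) : ℤ)) ↔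
        x = n + 1 ∨ x = -(n + 1) ∨ (x ≠ 0 ∧ |x| ≤ n) := by
      push_cast; rw [_root_.abs_le, _root_.abs_le]; omega
    rw [hx0, ← h.exists_mem_iff]
    constructor
    · rintro ⟨C, hC, hx⟩
      rw [mem_extendFamily] at hC
      rcases hC with rfl | rfl | hC
      · rcases Finset.mem_insert.1 hx with rfl | hx
        · simp
        · exact Or.inr (Or.inr ((h.exists_mem_iff x).2 (h.abs_le hB hx)))
      · rcases Finset.mem_insert.1 hx with rfl | hx
        · simp
        · exact Or.inr (Or.inr ((h.exists_mem_iff x).2 (h.abs_le (h.neg_mem_insert hB) hx)))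
      · exact Or.inr (Or.inr ⟨C, hC.2.2, hx⟩)
    · rintro (rfl | rfl | ⟨C, hC, hx⟩)
      · exact ⟨_, mem_extendFamily.2 (Or.inl rfl), by simp⟩
      · exact ⟨_, mem_extendFamily.2 (Or.inr (Or.inl rfl)), by simp⟩
      · by_cases h1 : C = B
        · exact ⟨_, mem_extendFamily.2 (Or.inl rfl), by simp [← h1, hx]⟩
        by_cases h2 : C = -B
        · exact ⟨_, mem_extendFamily.2 (Or.inr (Or.inl rfl)), by simp [← h2, hx]⟩
        exact ⟨C, mem_extendFamily.2 (Or.inr (Or.inr ⟨h2, h1, hC⟩)), hx⟩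
  eq_of_mem := by
    have key : ∀ D ∈ insert ∅ P, ∀ C ∈ P, ∀ x, x ∈ D → x ∈ C → C = D := by
      intro D hD C hC x hxD hxC
      rcases Finset.mem_insert.1 hD with rfl | hD
      · simp at hxD
      · exact h.eq_of_mem C hC D hD x hxC hxD
    have hnB := h.neg_mem_insert hB
    have hBB : ∀ x, x ∈ B → x ∉ -B := by
      intro x hx hx'
      rcases Finset.mem_insert.1 hB with rfl | hB
      · simp at hx
      · exact h.neg_notMem hB hx (by simpa [Finset.mem_neg'] using hx')
    have a1 := h.succ_notMem hB
    have a2 := h.neg_succ_notMem hB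
    have a3 := h.succ_notMem hnB
    have a4 := h.neg_succ_notMem hnB
    have a5 : (n + 1 : ℤ) ≠ -(n + 1) := by omega
    have a6 : ∀ C ∈ P, (n + 1 : ℤ) ∉ C := fun C hC => h.succ_notMem (by simp [hC])
    have a7 : ∀ C ∈ P, (-(n + 1) : ℤ) ∉ C := fun C hC => h.neg_succ_notMem (by simp [hC])
    have k1 := key B hB
    have k2 := key (-B) hnB
    have k3 := h.eq_of_mem
    intro C hC D hD x hxC hxD
    rw [mem_extendFamily] at hC hD
    rcases hC with rfl | rfl | hC <;> rcases hD with rfl | rfl | hD <;>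
      (try simp only [Finset.mem_insert] at hxC hxD) <;> grind
  neg_mem C hC := by
    rw [mem_extendFamily] at hC ⊢
    rcases hC with rfl | rfl | ⟨h1, h2, h3⟩
    · right; left; rw [Finset.neg_insert_int]
    · left; rw [Finset.neg_insert_int, neg_neg, neg_neg]
    · right; right
      exact ⟨fun h => h2 (neg_injective h), fun h => h1 (by rw [← h, neg_neg]), h.neg_mem C h3⟩
  ne_neg C hC := by
    have hnB := h.neg_mem_insert hB
    have a1 := h.succ_notMem hB
    have a2 := h.neg_succ_notMem hB
    have a3 := h.succ_notMem hnB
    have a4 := h.neg_succ_notMem hnB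
    have a5 : (n + 1 : ℤ) ≠ -(n + 1) := by omega
    rw [mem_extendFamily] at hC
    rcases hC with rfl | rfl | ⟨h1, h2, h3⟩
    · rw [Finset.neg_insert_int]
      intro h'
      have : (n + 1 : ℤ) ∈ insert (-(n + 1) : ℤ) (-B) := by rw [← h']; simp
      grind
    · rw [Finset.neg_insert_int]
      intro h'
      have : (-(n + 1) : ℤ) ∈ insert (-(-(n + 1)) : ℤ) (- -B) := by rw [← h']; simp
      rw [neg_neg, neg_neg] at this
      grind
    · exact h.ne_neg C h3

theorem card_extendFamily_of_mem (h : IsNoZeroFamily n P) (hB : B ∈ P) :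
    (_root_.extendFamily n P B).card = P.card := by
  have hB' : B ∈ insert ∅ P := Finset.mem_insert_of_mem hB
  have a6 : ∀ C ∈ P, (n + 1 : ℤ) ∉ C := fun C hC => h.succ_notMem (by simp [hC])
  have a7 : ∀ C ∈ P, (-(n + 1) : ℤ) ∉ C := fun C hC => h.neg_succ_notMem (by simp [hC])
  have hm : -B ∈ P.erase B := Finset.mem_erase.2 ⟨(h.ne_neg B hB).symm, h.neg_mem B hB⟩
  have a3 := h.succ_notMem (h.neg_mem_insert hB')
  rw [_root_.extendFamily, Finset.card_insert_of_notMem, Finset.card_insert_of_notMem,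
    Finset.card_erase_of_mem hm, Finset.card_erase_of_mem hB]
  · have := Finset.card_pos.2 ⟨_, hm⟩
    rw [Finset.card_erase_of_mem hB] at this
    omega
  · intro hc
    exact a7 _ (Finset.mem_of_mem_erase (Finset.mem_of_mem_erase hc)) (by simp)
  · intro hc
    rcases Finset.mem_insert.1 hc with hc | hc
    · have : (n + 1 : ℤ) ∈ insert (-(n + 1) : ℤ) (-B) := by rw [← hc]; simp
      rcases Finset.mem_insert.1 this with h1 | h1
      · omega
      · exact a3 h1
    · exact a6 _ (Finset.mem_of_mem_erase (Finset.mem_of_mem_erase hc)) (by simp)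

theorem card_extendFamily_empty (h : IsNoZeroFamily n P) :
    (_root_.extendFamily n P ∅).card = P.card + 2 := by
  have a6 : ∀ C ∈ P, (n + 1 : ℤ) ∉ C := fun C hC => h.succ_notMem (by simp [hC])
  have a7 : ∀ C ∈ P, (-(n + 1) : ℤ) ∉ C := fun C hC => h.neg_succ_notMem (by simp [hC])
  have he : (P.erase ∅).erase (-∅) = P := by
    simp [Finset.erase_eq_of_notMem h.empty_notMem]
  rw [_root_.extendFamily, he, Finset.card_insert_of_notMem, Finset.card_insert_of_notMem]
  · intro hc
    exact a7 _ hc (by simp)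
  · intro hc
    rcases Finset.mem_insert.1 hc with hc | hc
    · have : (n + 1 : ℤ) ∈ insert (-(n + 1) : ℤ) (-∅ : Finset ℤ) := by rw [← hc]; simp
      simp at this
      omega
    · exact a6 _ hc (by simp)

/-- The block containing n+1 determines B; every block of P other than B and -B survives unchanged,
and B, -B are then known. -/
theorem extendFamily_injective {P₁ P₂ : Finset (Finset ℤ)} {B₁ B₂ : Finset ℤ}
    (h₁ : IsNoZeroFamily n P₁) (hB₁ : B₁ ∈ insert ∅ P₁) (h₂ : IsNoZeroFamily n P₂)
    (hB₂ : B₂ ∈ insert ∅ P₂) (he : _root_.extendFamily n P₁ B₁ = _root_.extendFamily n P₂ B₂) :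
    P₁ = P₂ ∧ B₁ = B₂ := by
  have hB : B₁ = B₂ := by
    have hm : insert (n + 1 : ℤ) B₁ ∈ _root_.extendFamily n P₂ B₂ := by
      rw [← he]; exact mem_extendFamily.2 (Or.inl rfl)
    have := (h₂.extendFamily hB₂).eq_of_mem _ hm _ (mem_extendFamily.2 (Or.inl rfl)) (n + 1)
      (by simp) (by simp)
    rw [← Finset.erase_insert (h₁.succ_notMem hB₁), this,
      Finset.erase_insert (h₂.succ_notMem hB₂)]
  subst hB
  refine ⟨?_, rfl⟩
  have key : ∀ {P Q : Finset (Finset ℤ)}, IsNoZeroFamily n P → B₁ ∈ insert ∅ P →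
      IsNoZeroFamily n Q → B₁ ∈ insert ∅ Q →
      _root_.extendFamily n P B₁ = _root_.extendFamily n Q B₁ → P ⊆ Q := by
    intro P Q hP hBP hQ hBQ he C hC
    have hC0 : C ≠ ∅ := fun h0 => hP.empty_notMem (h0 ▸ hC)
    by_cases h1 : C = B₁
    · subst h1
      exact (Finset.mem_insert.1 hBQ).resolve_left hC0
    by_cases h2 : C = -B₁
    · subst h2
      exact (Finset.mem_insert.1 (hQ.neg_mem_insert hBQ)).resolve_left hC0
    have hm : C ∈ _root_.extendFamily n Q B₁ := by
      rw [← he]; exact mem_extendFamily.2 (Or.inr (Or.inr ⟨h2, h1, hC⟩))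
    rcases mem_extendFamily.1 hm with h3 | h3 | h3
    · exact absurd (by rw [h3]; simp) (hP.succ_notMem (Finset.mem_insert_of_mem hC))
    · exact absurd (by rw [h3]; simp) (hP.neg_succ_notMem (Finset.mem_insert_of_mem hC))
    · exact h3.2.2
  exact (key h₁ hB₁ h₂ hB₂ he).antisymm (key h₂ hB₂ h₁ hB₁ he.symm)

/-- Delete n+1 from its block C and -(n+1) from -C. These two blocks differ because C is not a
zero-block. -/
theorem exists_extendFamily_eq {Q : Finset (Finset ℤ)} (h : IsNoZeroFamily (n + 1) Q) :
    ∃ P B, IsNoZeroFamily n P ∧ B ∈ insert ∅ P ∧ _root_.extendFamily n P B = Q := by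
  obtain ⟨C, hC, hmC⟩ := (h.exists_mem_iff (n + 1)).2 (by
    push_cast; rw [_root_.abs_le]; omega)
  have hnC := h.neg_mem C hC
  have hne := h.ne_neg C hC
  have hmC' : (-(n + 1) : ℤ) ∉ C := h.neg_notMem hC hmC
  set B := C.erase (n + 1 : ℤ) with hBdef
  have hCB : insert (n + 1 : ℤ) B = C := Finset.insert_erase hmC
  have hnCB : insert (-(n + 1) : ℤ) (-B) = -C := by rw [← Finset.neg_insert_int, hCB]
  have hBC : ∀ x, x ∈ B ↔ x ≠ n + 1 ∧ x ∈ C := fun x => by simp [hBdef]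
  have hnBC : ∀ x, x ∈ -B ↔ x ≠ -(n + 1) ∧ -x ∈ C := fun x => by
    simp [hBdef, Finset.mem_neg', neg_eq_iff_eq_neg]
  have hBn : B ≠ ∅ → B ≠ -B := by
    intro hB0 hBB
    obtain ⟨x, hx⟩ := Finset.nonempty_iff_ne_empty.2 hB0
    have hx' := hx
    rw [hBB, hnBC] at hx'
    exact h.neg_notMem hC ((hBC x).1 hx).2 hx'.2
  -- If C is the singleton {n+1}, then B and -B are empty; the outer `erase ∅` discards them.
  set P := (insert B (insert (-B) ((Q.erase C).erase (-C)))).erase ∅ with hPdef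
  have hP : ∀ D, D ∈ P ↔ D ≠ ∅ ∧ (D = B ∨ D = -B ∨ (D ≠ -C ∧ D ≠ C ∧ D ∈ Q)) := by
    intro D; simp [hPdef]
  have hQm : ∀ D ∈ Q, (n + 1 : ℤ) ∈ D → D = C := fun D hD hm =>
    h.eq_of_mem D hD C hC _ hm hmC
  have hQm' : ∀ D ∈ Q, (-(n + 1) : ℤ) ∈ D → D = -C := fun D hD hm =>
    h.eq_of_mem D hD (-C) hnC _ hm (by simpa [Finset.mem_neg'] using hmC)
  have hBQ : B ∉ Q := by
    intro hB
    obtain ⟨x, hx⟩ := Finset.nonempty_iff_ne_empty.2 (fun h0 => h.empty_notMem (h0 ▸ hB))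
    have := h.eq_of_mem B hB C hC x hx ((hBC x).1 hx).2
    rw [← this] at hmC
    exact ((hBC _).1 hmC).1 rfl
  have hnBQ : -B ∉ Q := by
    intro hB
    exact hBQ (by simpa using h.neg_mem _ hB)
  refine ⟨P, B, ⟨by simp [hPdef], fun x => ?_, ?_, ?_, ?_⟩, ?_, ?_⟩
  · have hx0 : (x ≠ 0 ∧ |x| ≤ (n : ℤ)) ↔
        x ≠ n + 1 ∧ x ≠ -(n + 1) ∧ (x ≠ 0 ∧ |x| ≤ ((n + 1 : ℕ) : ℤ)) := by
      push_cast; rw [_root_.abs_le, _root_.abs_le]; omega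
    rw [hx0, ← h.exists_mem_iff]
    constructor
    · rintro ⟨D, hD, hx⟩
      rcases (hP D).1 hD with ⟨h0, rfl | rfl | ⟨h1, h2, h3⟩⟩
      · have := (hBC x).1 hx
        exact ⟨this.1, fun h => hmC' (h ▸ this.2), C, hC, this.2⟩
      · have := (hnBC x).1 hx
        exact ⟨fun h => hmC' (h ▸ this.2), this.1, -C, hnC, by simpa [Finset.mem_neg'] using this.2⟩
      · exact ⟨fun h => h2 (hQm D h3 (h ▸ hx)), fun h => h1 (hQm' D h3 (h ▸ hx)), D, h3, hx⟩
    · rintro ⟨h1, h2, D, hD, hx⟩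
      by_cases hDC : D = C
      · subst hDC
        have : x ∈ B := (hBC x).2 ⟨h1, hx⟩
        exact ⟨B, (hP B).2 ⟨Finset.ne_empty_of_mem this, Or.inl rfl⟩, this⟩
      by_cases hDC' : D = -C
      · subst hDC'
        have : x ∈ -B := (hnBC x).2 ⟨h2, by simpa [Finset.mem_neg'] using hx⟩
        exact ⟨-B, (hP _).2 ⟨Finset.ne_empty_of_mem this, Or.inr (Or.inl rfl)⟩, this⟩
      exact ⟨D, (hP D).2 ⟨Finset.ne_empty_of_mem hx, Or.inr (Or.inr ⟨hDC', hDC, hD⟩)⟩, hx⟩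
  · have hBB : ∀ x, x ∈ B → x ∉ -B := by
      intro x hx hx'
      exact h.neg_notMem hC ((hBC x).1 hx).2 ((hnBC x).1 hx').2
    have k1 : ∀ D ∈ Q, ∀ x, x ∈ D → x ∈ B → D = C := fun D hD x hx hxB =>
      h.eq_of_mem D hD C hC x hx ((hBC x).1 hxB).2
    have k2 : ∀ D ∈ Q, ∀ x, x ∈ D → x ∈ -B → D = -C := fun D hD x hx hxB =>
      h.eq_of_mem D hD (-C) hnC x hx (by simpa [Finset.mem_neg'] using ((hnBC x).1 hxB).2)
    have k3 := h.eq_of_mem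
    intro D hD E hE x hxD hxE
    rcases (hP D).1 hD with ⟨-, rfl | rfl | ⟨h1, h2, h3⟩⟩ <;>
      rcases (hP E).1 hE with ⟨-, rfl | rfl | ⟨h4, h5, h6⟩⟩ <;> grind
  · intro D hD
    have hn0 : ∀ E : Finset ℤ, E ≠ ∅ → -E ≠ ∅ := fun E hE h0 => hE (by simpa using h0)
    rcases (hP D).1 hD with ⟨h0, rfl | rfl | ⟨h1, h2, h3⟩⟩
    · exact (hP _).2 ⟨hn0 _ h0, Or.inr (Or.inl rfl)⟩
    · exact (hP _).2 ⟨hn0 _ h0, Or.inl (neg_neg _)⟩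
    · exact (hP _).2 ⟨hn0 _ h0, Or.inr (Or.inr ⟨fun h => h2 (neg_injective h),
        fun h => h1 (by rw [← h, neg_neg]), h.neg_mem D h3⟩)⟩
  · intro D hD
    rcases (hP D).1 hD with ⟨h0, rfl | rfl | ⟨h1, h2, h3⟩⟩
    · exact hBn h0
    · rw [neg_neg]
      exact (hBn (fun h => h0 (by simp [h]))).symm
    · exact h.ne_neg D h3
  · by_cases h0 : B = ∅
    · simp [h0]
    · exact Finset.mem_insert_of_mem ((hP B).2 ⟨h0, Or.inl rfl⟩)
  · ext D
    rw [mem_extendFamily, hCB, hnCB, hP]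
    constructor
    · rintro (rfl | rfl | ⟨h1, h2, -, h3⟩)
      · exact hC
      · exact hnC
      · grind
    · intro hD
      by_cases h1 : D = C
      · exact Or.inl h1
      by_cases h2 : D = -C
      · exact Or.inr (Or.inl h2)
      refine Or.inr (Or.inr ⟨fun h => hnBQ (h ▸ hD), fun h => hBQ (h ▸ hD),
        fun h' => h.empty_notMem (h' ▸ hD), Or.inr (Or.inr ⟨h2, h1, hD⟩)⟩)

end IsNoZeroFamily

/-- Every family at level n+1 arises once from a pair (P, B): B = ∅ adds two blocks, and each of the
`P.card` genuine choices of B keeps the count. Arbitrary `f` lets one recurrence serve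
cardinalities, powers of X and falling factorials. -/
theorem sum_noZeroFamilies_succ {M : Type*} [AddCommMonoid M] (n : ℕ) (f : ℕ → M) :
    ∑ P ∈ noZeroFamilies (n + 1), f P.card =
      ∑ P ∈ noZeroFamilies n, (f (P.card + 2) + P.card • f P.card) := by
  have h1 : ∀ P ∈ noZeroFamilies n, f (P.card + 2) + P.card • f P.card =
      ∑ B ∈ insert ∅ P, f (extendFamily n P B).card := by
    intro P hP
    rw [mem_noZeroFamilies] at hP
    rw [Finset.sum_insert hP.empty_notMem, hP.card_extendFamily_empty,
      Finset.sum_congr rfl fun B hB => by rw [hP.card_extendFamily_of_mem hB], Finset.sum_const]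
  rw [Finset.sum_congr rfl h1, Finset.sum_sigma']
  symm
  refine Finset.sum_bij (fun x _ => extendFamily n x.1 x.2) ?_ ?_ ?_ (fun _ _ => rfl)
  · rintro ⟨P, B⟩ h
    rw [Finset.mem_sigma, mem_noZeroFamilies] at h
    exact mem_noZeroFamilies.2 (h.1.extendFamily h.2)
  · rintro ⟨P₁, B₁⟩ h₁ ⟨P₂, B₂⟩ h₂ he
    rw [Finset.mem_sigma, mem_noZeroFamilies] at h₁ h₂
    obtain ⟨rfl, rfl⟩ := h₁.1.extendFamily_injective h₁.2 h₂.1 h₂.2 he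
    rfl
  · intro Q hQ
    obtain ⟨P, B, hP, hB, rfl⟩ := (mem_noZeroFamilies.1 hQ).exists_extendFamily_eq
    exact ⟨⟨P, B⟩, Finset.mem_sigma.2 ⟨mem_noZeroFamilies.2 hP, hB⟩, rfl⟩

theorem noZeroFamilies_zero : noZeroFamilies 0 = {∅} := by
  ext P
  rw [mem_noZeroFamilies, Finset.mem_singleton]
  constructor
  · intro h
    rw [Finset.eq_empty_iff_forall_notMem]
    intro B hB
    obtain ⟨x, hx⟩ := Finset.nonempty_iff_ne_empty.2 (fun h0 => h.empty_notMem (h0 ▸ hB))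
    have := (h.exists_mem_iff x).1 ⟨B, hB, hx⟩
    simp at this
  · rintro rfl
    refine ⟨by simp, fun x => ?_, by simp, by simp, by simp⟩
    simp

/-! ### Transfer to partitions and block pairs. -/

theorem BPartitionNoZero.isNoZeroFamily {n : ℕ} (π : BPartitionNoZero n) :
    IsNoZeroFamily n π.1.parts where
  empty_notMem := π.1.bot_notMem
  exists_mem_iff x := by
    rw [← mem_signedSet]
    constructor
    · rintro ⟨B, hB, hx⟩
      exact π.1.le hB hx
    · intro hx
      exact π.1.exists_mem hx
  eq_of_mem _ hB _ hC _ hxB hxC := π.1.eq_of_mem_parts hB hC hxB hxC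
  neg_mem := π.2.1.neg_mem
  ne_neg := π.2.2

theorem IsNoZeroFamily.exists_parts_eq {n : ℕ} {P : Finset (Finset ℤ)} (h : IsNoZeroFamily n P) :
    ∃ π : BPartitionNoZero n, π.1.parts = P := by
  refine ⟨⟨⟨P, ?_, ?_, h.empty_notMem⟩, ⟨h.neg_mem, ?_⟩, h.ne_neg⟩, rfl⟩
  · rw [Finset.supIndep_iff_pairwiseDisjoint]
    intro B hB C hC hne
    refine Finset.disjoint_left.2 fun x hxB hxC => hne (h.eq_of_mem B hB C hC x hxB hxC)
  · ext x
    rw [Finset.mem_sup, mem_signedSet, ← h.exists_mem_iff]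
    rfl
  · exact fun B hB _ _ hz _ => absurd hz (h.ne_neg B hB)

/-- The map from B to the pair {B, -B} is two-to-one, since B ≠ -B. -/
theorem BPartitionNoZero.card_parts {n : ℕ} (π : BPartitionNoZero n) :
    π.1.parts.card = 2 * (blockPairs π.1).card := by
  have h := π.isNoZeroFamily
  have hf : (π.1.parts.filter fun B => ¬ IsZeroBlock B) = π.1.parts :=
    Finset.filter_true_of_mem π.2.2
  rw [blockPairs, hf, Finset.card_eq_sum_card_image (fun B => s(B, -B)),
    Finset.sum_const_nat (m := 2), mul_comm]
  intro p hp
  obtain ⟨B, hB, rfl⟩ := Finset.mem_image.1 hp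
  have : π.1.parts.filter (fun C => s(C, -C) = s(B, -B)) = {B, -B} := by
    ext C
    simp only [Finset.mem_filter, Sym2.eq_iff, Finset.mem_insert, Finset.mem_singleton]
    constructor
    · rintro ⟨-, h1 | h1⟩
      · exact Or.inl h1.1
      · exact Or.inr h1.1
    · rintro (rfl | rfl)
      · exact ⟨hB, Or.inl ⟨rfl, rfl⟩⟩
      · exact ⟨h.neg_mem B hB, Or.inr ⟨rfl, neg_neg B⟩⟩
  rw [this, Finset.card_pair (h.ne_neg B hB)]

noncomputable instance (n : ℕ) : Fintype (BPartitionNoZero n) := Fintype.ofFinite _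

section sums

variable {M : Type*} [AddCommMonoid M]

theorem sum_card_blockPairs (n : ℕ) (f : ℕ → M) :
    ∑ π : BPartitionNoZero n, f (blockPairs π.1).card =
      ∑ P ∈ noZeroFamilies n, f (P.card / 2) := by
  refine Finset.sum_bij (fun π _ => π.1.parts) ?_ ?_ ?_ ?_
  · exact fun π _ => mem_noZeroFamilies.2 π.isNoZeroFamily
  · exact fun π _ ρ _ h => Subtype.ext (Finpartition.ext h)
  · intro P hP
    obtain ⟨π, hπ⟩ := (mem_noZeroFamilies.1 hP).exists_parts_eq
    exact ⟨π, Finset.mem_univ _, hπ⟩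
  · intro π _
    rw [π.card_parts, Nat.mul_div_cancel_left _ two_pos]

/-- Removing `±(n + 1)` from a partition: either two singleton blocks disappear, or one of the
blocks and its negative are shortened. -/
theorem sum_card_blockPairs_succ (n : ℕ) (f : ℕ → M) :
    ∑ π : BPartitionNoZero (n + 1), f (blockPairs π.1).card =
      ∑ π : BPartitionNoZero n, (f ((blockPairs π.1).card + 1) +
        (2 * (blockPairs π.1).card) • f (blockPairs π.1).card) := by
  rw [sum_card_blockPairs, sum_noZeroFamilies_succ n fun c => f (c / 2)]
  symm
  refine Finset.sum_bij (fun π _ => π.1.parts) ?_ ?_ ?_ ?_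
  · exact fun π _ => mem_noZeroFamilies.2 π.isNoZeroFamily
  · exact fun π _ ρ _ h => Subtype.ext (Finpartition.ext h)
  · intro P hP
    obtain ⟨π, hπ⟩ := (mem_noZeroFamilies.1 hP).exists_parts_eq
    exact ⟨π, Finset.mem_univ _, hπ⟩
  · intro π _
    rw [π.card_parts, Nat.mul_div_cancel_left _ two_pos, Nat.add_div_right _ two_pos,
      Nat.mul_div_cancel_left _ two_pos]

theorem sum_card_blockPairs_zero (f : ℕ → M) :
    ∑ π : BPartitionNoZero 0, f (blockPairs π.1).card = f 0 := by
  rw [sum_card_blockPairs, noZeroFamilies_zero]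
  simp

end sums

theorem integral_unifBPartitionNoZero {E : Type*} [NormedAddCommGroup E] [NormedSpace ℝ E]
    [CompleteSpace E] (n : ℕ)
    (g : BPartitionNoZero n → E) :
    ∫ ρ, g ρ ∂(unifBPartitionNoZero n) =
      (Fintype.card (BPartitionNoZero n) : ℝ)⁻¹ • ∑ ρ, g ρ := by
  have h : ∀ ρ, (unifBPartitionNoZero n).real {ρ} = (Fintype.card (BPartitionNoZero n) : ℝ)⁻¹ := by
    intro ρ
    rw [unifBPartitionNoZero, Measure.real, uniformOn_univ, Measure.count_singleton]
    simp
  rw [integral_fintype (.of_finite)]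
  simp_rw [h, ← Finset.smul_sum]

/-! ### Real-rootedness and factorization of the generating polynomial. -/

section roots

open Polynomial

/-- For real r, Im 1/(z-r) = -Im z / |z-r|^2, so all summands have imaginary parts of the same sign;
a is the sum of the 1/|z-r|^2. -/
theorem exists_im_sum_inv_sub (z : ℂ) (s : Multiset ℂ) (hs : ∀ r ∈ s, r.im = 0) (hz : z.im ≠ 0) :
    ∃ a : ℝ, 0 ≤ a ∧ (s ≠ 0 → 0 < a) ∧ (s.map fun r => 1 / (z - r)).sum.im = -z.im * a := by
  induction s using Multiset.induction_on with
  | empty => exact ⟨0, le_rfl, by simp, by simp⟩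
  | cons r s ih =>
    obtain ⟨a, ha, -, h⟩ := ih fun r hr => hs r (Multiset.mem_cons_of_mem hr)
    have hr := hs r (Multiset.mem_cons_self r s)
    have hne : z - r ≠ 0 := by
      intro h0
      have := congrArg Complex.im h0
      simp [hr] at this
      exact hz this
    have hpos := Complex.normSq_pos.2 hne
    refine ⟨1 / Complex.normSq (z - r) + a, by positivity, fun _ => by positivity, ?_⟩
    rw [Multiset.map_cons, Multiset.sum_cons, Complex.add_im, h]
    simp [hr]
    ring

/-- If all roots of `p` are real, then so are those of `p + c p'` for real `c`. -/
theorem im_eq_zero_of_eval_add_derivative {p : ℂ[X]} (hp : ∀ z, p.eval z = 0 → z.im = 0) (c : ℝ)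
    {z : ℂ} (hz : (p + C (c : ℂ) * derivative p).eval z = 0) : z.im = 0 := by
  by_contra him
  have hpz : p.eval z ≠ 0 := fun h => him (hp z h)
  have h0 : p ≠ 0 := by rintro rfl; simp at hpz
  have h1 := (IsAlgClosed.splits p).eval_derivative_div_eval_of_ne_zero hpz
  obtain ⟨a, ha, ha', h⟩ := exists_im_sum_inv_sub z p.roots
    (fun r hr => hp r ((mem_roots h0).1 hr)) him
  rw [← h1] at h
  -- At a nonreal zero, 1 + c p'/p = 0, while p'/p = Σ 1/(z-r) has nonzero imaginary part as soon as
  -- p has a root.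
  have h2 : 1 + (c : ℂ) * ((derivative p).eval z / p.eval z) = 0 := by
    simp at hz
    rw [← mul_div_assoc, ← div_self hpz, ← add_div, hz, zero_div]
  have h3 := congrArg Complex.im h2
  rw [Complex.add_im, Complex.im_ofReal_mul, h] at h3
  simp only [Complex.one_im, zero_add, Complex.zero_im] at h3
  have hc : c ≠ 0 := by rintro rfl; simp at h2
  by_cases hr : p.roots = 0
  · rw [h1, hr] at h2
    simp at h2
  · have := ha' hr
    have := mul_ne_zero hc (mul_ne_zero (neg_ne_zero.2 him) this.ne')
    exact this h3

/-- The generating polynomial of the number of block pairs. -/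
noncomputable def blockPairPoly (n : ℕ) : ℂ[X] :=
  ∑ π : BPartitionNoZero n, X ^ (blockPairs π.1).card

/-- Termwise, x^(k+1) + 2k x^k = x(x^k + 2(x^k)'). The constant is written as a real cast to fit
`im_eq_zero_of_eval_add_derivative`. -/
theorem blockPairPoly_succ (n : ℕ) :
    blockPairPoly (n + 1) =
      X * (blockPairPoly n + C ((2 : ℝ) : ℂ) * derivative (blockPairPoly n)) := by
  rw [blockPairPoly, sum_card_blockPairs_succ n fun k => (X ^ k : ℂ[X]), blockPairPoly,
    derivative_sum, Finset.mul_sum, ← Finset.sum_add_distrib, Finset.mul_sum]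
  refine Finset.sum_congr rfl fun π _ => ?_
  rw [derivative_X_pow]
  rcases (blockPairs π.1).card with _ | k
  · simp
  · simp [pow_succ, ← C_ofNat]
    ring

theorem eval_blockPairPoly (n : ℕ) (z : ℂ) :
    (blockPairPoly n).eval z = ∑ π : BPartitionNoZero n, z ^ (blockPairs π.1).card := by
  simp [blockPairPoly, eval_finsetSum]

theorem im_eq_zero_of_eval_blockPairPoly (n : ℕ) :
    ∀ z, (blockPairPoly n).eval z = 0 → z.im = 0 := by
  induction n with
  | zero =>
    intro z hz
    rw [eval_blockPairPoly, sum_card_blockPairs_zero fun k => z ^ k] at hz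
    simp at hz
  | succ n ih =>
    intro z hz
    rw [blockPairPoly_succ, eval_mul, eval_X, mul_eq_zero] at hz
    rcases hz with rfl | hz
    · simp
    · exact im_eq_zero_of_eval_add_derivative ih 2 hz

/-- Roots are real, and at a positive real every term of the polynomial is positive. -/
theorem re_nonpos_of_eval_blockPairPoly (n : ℕ) (z : ℂ) (hz : (blockPairPoly n).eval z = 0) :
    z.re ≤ 0 := by
  by_contra! h
  have hz' : z = (z.re : ℂ) := by
    apply Complex.ext <;> simp [im_eq_zero_of_eval_blockPairPoly n z hz]
  rw [eval_blockPairPoly, hz'] at hz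
  have : ∑ π : BPartitionNoZero n, z.re ^ (blockPairs π.1).card = 0 := by exact_mod_cast hz
  have h2 : 0 < ∑ π : BPartitionNoZero n, z.re ^ (blockPairs π.1).card :=
    Finset.sum_pos (fun _ _ => by positivity) Finset.univ_nonempty
  exact h2.ne' this

theorem exists_blockPairPoly_eq_prod (n : ℕ) :
    ∃ s : Multiset ℝ, (∀ p ∈ s, 0 ≤ p ∧ p ≤ 1) ∧
      blockPairPoly n = C (Fintype.card (BPartitionNoZero n) : ℂ) *
        (s.map fun p : ℝ => C (1 - (p : ℂ)) + C (p : ℂ) * X).prod := by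
  have h0 : blockPairPoly n ≠ 0 := by
    intro h0
    have := re_nonpos_of_eval_blockPairPoly n 1 (by rw [h0]; simp)
    simp at this
    linarith
  have hr : ∀ r ∈ (blockPairPoly n).roots, r.im = 0 ∧ r.re ≤ 0 := fun r hr =>
    ⟨im_eq_zero_of_eval_blockPairPoly n r ((mem_roots h0).1 hr),
      re_nonpos_of_eval_blockPairPoly n r ((mem_roots h0).1 hr)⟩
  -- A root r ≤ 0 gives X - r = (1-r)((1-p) + pX) with p = 1/(1-r).
  refine ⟨(blockPairPoly n).roots.map fun r => 1 / (1 - r.re), ?_, ?_⟩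
  · intro p hp
    obtain ⟨r, hr', rfl⟩ := Multiset.mem_map.1 hp
    have := (hr r hr').2
    exact ⟨by apply div_nonneg <;> linarith, (div_le_one (by linarith)).2 (by linarith)⟩
  have key : ∀ s : Multiset ℂ, (∀ r ∈ s, r.im = 0 ∧ r.re ≤ 0) →
      (s.map fun r => X - C r).prod = C ((s.map fun r => (1 - r)).prod) *
        ((s.map fun r => 1 / (1 - r.re)).map fun p : ℝ => C (1 - (p : ℂ)) + C (p : ℂ) * X).prod := by
    intro s hs
    induction s using Multiset.induction_on with
    | empty => simp
    | cons r s ih =>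
      obtain ⟨h1, h2⟩ := hs r (Multiset.mem_cons_self r s)
      have hr' : r = (r.re : ℂ) := by apply Complex.ext <;> simp [h1]
      have hne : (1 - (r.re : ℂ)) ≠ 0 := by
        have : (1 - r.re : ℝ) ≠ 0 := by linarith
        exact_mod_cast this
      have hlin : X - C r = C (1 - r) * (C (1 - ((1 / (1 - r.re) : ℝ) : ℂ)) +
          C ((1 / (1 - r.re) : ℝ) : ℂ) * X) := by
        rw [mul_add, ← mul_assoc, ← C_mul, ← C_mul]
        push_cast
        rw [← hr'] at hne ⊢
        have e1 : (1 - r) * (1 - 1 / (1 - r)) = -r := by field_simp; ring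
        have e2 : (1 - r) * (1 / (1 - r)) = 1 := by field_simp
        rw [e1, e2]
        simp
        ring
      simp only [Multiset.map_cons, Multiset.prod_cons]
      rw [ih fun r hr => hs r (Multiset.mem_cons_of_mem hr), hlin, C_mul]
      ring
  have hD := (IsAlgClosed.splits (blockPairPoly n)).eq_prod_roots
  rw [key _ hr, ← mul_assoc, ← C_mul] at hD
  -- Each normalized factor equals 1 at x = 1, so evaluation there identifies the leading constant.
  have h1 : (blockPairPoly n).eval 1 = Fintype.card (BPartitionNoZero n) := by
    simp [eval_blockPairPoly]
  have h2 : ∀ s : Multiset ℝ,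
      ((s.map fun p : ℝ => C (1 - (p : ℂ)) + C (p : ℂ) * X).prod).eval 1 = 1 := by
    intro s
    induction s using Multiset.induction_on with
    | empty => simp
    | cons r s ih =>
      rw [Multiset.map_cons, Multiset.prod_cons, eval_mul, ih]
      simp
  have h3 := h1
  rw [hD, eval_mul, h2, eval_C, mul_one] at h3
  rw [← h3]
  exact hD

/-- The derivatives at 1 are the factorial moments E[S] and E[S(S-1)] of a Bernoulli sum; they yield
its mean and variance. -/
theorem eval_derivative_prod_bernoulli {R ι : Type*} [CommRing R] (s : Multiset ι) (p : ι → R) :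
    ((s.map fun i => C (1 - p i) + C (p i) * X).prod).eval 1 = 1 ∧
    (derivative (s.map fun i => C (1 - p i) + C (p i) * X).prod).eval 1 = (s.map p).sum ∧
    (derivative (derivative (s.map fun i => C (1 - p i) + C (p i) * X).prod)).eval 1 =
      (s.map p).sum ^ 2 - (s.map fun i => p i ^ 2).sum := by
  induction s using Multiset.induction_on with
  | empty => simp
  | cons i s ih =>
    obtain ⟨h1, h2, h3⟩ := ih
    simp only [Multiset.map_cons, Multiset.prod_cons, Multiset.sum_cons, derivative_mul,
      derivative_add, derivative_C, derivative_X, derivative_zero, derivative_one, eval_add, eval_mul, eval_C, eval_X, h1, h2, h3,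
      eval_zero, eval_one]
    refine ⟨by ring, by ring, by ring⟩

end roots

/-- The number of block pairs has the law of a sum of independent Bernoulli variables. -/
theorem exists_bernoulli_numBlockPairs (n : ℕ) :
    ∃ s : Multiset ℝ, (∀ p ∈ s, 0 ≤ p ∧ p ≤ 1) ∧
      (∀ z : ℂ, ∑ π : BPartitionNoZero n, z ^ (blockPairs π.1).card =
        Fintype.card (BPartitionNoZero n) * (s.map fun p : ℝ => 1 - (p : ℂ) + p * z).prod) ∧
      ∫ ρ, numBlockPairs n ρ ∂(unifBPartitionNoZero n) = s.sum ∧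
      variance (numBlockPairs n) (unifBPartitionNoZero n) = (s.map fun p => p * (1 - p)).sum := by
  obtain ⟨s, hs, hD⟩ := exists_blockPairPoly_eq_prod n
  obtain ⟨h1, h2, h3⟩ := eval_derivative_prod_bernoulli s (fun p : ℝ => (p : ℂ))
  have hA : (Fintype.card (BPartitionNoZero n) : ℝ) ≠ 0 := by
    exact_mod_cast Fintype.card_ne_zero
  have e1 : ∑ π : BPartitionNoZero n, ((blockPairs π.1).card : ℝ) =
      Fintype.card (BPartitionNoZero n) * s.sum := by
    have := congrArg (fun q => (Polynomial.derivative q).eval 1) hD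
    simp only [Polynomial.derivative_C_mul, Polynomial.eval_mul, Polynomial.eval_C, h2] at this
    rw [blockPairPoly, Polynomial.derivative_sum, Polynomial.eval_finsetSum] at this
    have hc : (s.map fun p : ℝ => (p : ℂ)).sum = ((s.sum : ℝ) : ℂ) :=
      (map_multiset_sum Complex.ofRealHom s).symm
    have hk : ∀ k : ℕ, (Polynomial.derivative (Polynomial.X ^ k : Polynomial ℂ)).eval 1 = k := by
      intro k
      simp [Polynomial.derivative_X_pow]
    rw [hc, Finset.sum_congr rfl fun π _ => hk _] at this
    exact_mod_cast this
  have e2 : ∑ π : BPartitionNoZero n, ((blockPairs π.1).card : ℝ) ^ 2 =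
      Fintype.card (BPartitionNoZero n) * (s.sum ^ 2 - (s.map fun p => p ^ 2).sum + s.sum) := by
    have := congrArg (fun q => (Polynomial.derivative (Polynomial.derivative q)).eval 1) hD
    simp only [Polynomial.derivative_C_mul, Polynomial.eval_mul, Polynomial.eval_C, h3] at this
    rw [blockPairPoly, Polynomial.derivative_sum, Polynomial.derivative_sum,
      Polynomial.eval_finsetSum] at this
    have hc : (s.map fun p : ℝ => (p : ℂ)).sum = ((s.sum : ℝ) : ℂ) :=
      (map_multiset_sum Complex.ofRealHom s).symm
    have hc2 : (s.map fun p : ℝ => (p : ℂ) ^ 2).sum = (((s.map fun p => p ^ 2).sum : ℝ) : ℂ) := by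
      rw [← Complex.ofRealHom_eq_coe, map_multiset_sum Complex.ofRealHom, Multiset.map_map]
      simp
    have hk : ∀ k : ℕ, (Polynomial.derivative (Polynomial.derivative
        (Polynomial.X ^ k : Polynomial ℂ))).eval 1 = (k : ℂ) ^ 2 - k := by
      intro k
      rcases k with _ | k
      · simp
      · rw [Polynomial.derivative_X_pow, Polynomial.derivative_C_mul, Polynomial.derivative_X_pow]
        simp
        ring
    rw [hc, hc2, Finset.sum_congr rfl fun π _ => hk _, Finset.sum_sub_distrib] at this
    have e1' : ∑ π : BPartitionNoZero n, ((blockPairs π.1).card : ℂ) =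
      Fintype.card (BPartitionNoZero n) * ((s.sum : ℝ) : ℂ) := by exact_mod_cast e1
    rw [e1', sub_eq_iff_eq_add, ← mul_add] at this
    exact_mod_cast this
  refine ⟨s, hs, fun z => ?_, ?_, ?_⟩
  · rw [← eval_blockPairPoly, hD, Polynomial.eval_mul, Polynomial.eval_multiset_prod]
    simp
  · rw [integral_unifBPartitionNoZero]
    simp only [numBlockPairs, e1, smul_eq_mul]
    field_simp
  · rw [variance_eq_sub (MemLp.of_discrete), integral_unifBPartitionNoZero,
      integral_unifBPartitionNoZero]
    simp only [numBlockPairs, Pi.pow_apply, e1, e2, smul_eq_mul]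
    have : (s.map fun p => p * (1 - p)).sum = s.sum - (s.map fun p => p ^ 2).sum := by
      have : ∀ p : ℝ, p * (1 - p) = p - p ^ 2 := fun p => by ring
      simp_rw [this, Multiset.sum_map_sub, Multiset.map_id']
    rw [this]
    field_simp
    ring

/-! ### Dobiński-type series. -/

/-- The `j`-th term of the Dobiński series for the number of `B_n`-partitions without
zero-block. -/
noncomputable def dobinskiTerm (n j : ℕ) : ℝ := (2 * j) ^ n * (1 / 2) ^ j / j.factorial

theorem dobinskiTerm_nonneg (n j : ℕ) : 0 ≤ dobinskiTerm n j := by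
  unfold dobinskiTerm; positivity

theorem dobinskiTerm_succ (n j : ℕ) : dobinskiTerm (n + 1) j = 2 * j * dobinskiTerm n j := by
  unfold dobinskiTerm; ring

/-- Induction through the partition recurrence, using j (j)_k = (j)_{k+1} + k (j)_k for falling
factorials. -/
theorem two_mul_pow_eq_sum_descFactorial (n j : ℕ) :
    (2 * j : ℝ) ^ n = ∑ π : BPartitionNoZero n,
      (2 : ℝ) ^ (blockPairs π.1).card * j.descFactorial (blockPairs π.1).card := by
  induction n with
  | zero =>
    rw [sum_card_blockPairs_zero fun k => (2 : ℝ) ^ k * j.descFactorial k]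
    simp
  | succ n ih =>
    rw [sum_card_blockPairs_succ n fun k => (2 : ℝ) ^ k * j.descFactorial k, pow_succ, ih,
      Finset.sum_mul]
    refine Finset.sum_congr rfl fun π _ => ?_
    generalize (blockPairs π.1).card = k
    rw [Nat.descFactorial_succ, nsmul_eq_mul]
    -- For k > j the natural subtraction j - k truncates, but the falling factorials vanish.
    rcases le_or_gt k j with h | h
    · push_cast [Nat.cast_sub h]
      ring
    · simp [Nat.descFactorial_of_lt h]

/-- This is the k-th factorial moment (1/2)^k of a Poisson(1/2) variable, rescaled. The value does
not depend on k, so summing over partitions merely counts them. -/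
theorem hasSum_descFactorial (k : ℕ) :
    HasSum (fun j : ℕ => (2 : ℝ) ^ k * j.descFactorial k * (1 / 2) ^ j / j.factorial)
      (Real.exp (1 / 2)) := by
  rw [← hasSum_nat_add_iff' k, Finset.sum_eq_zero, sub_zero]
  · have h := NormedSpace.expSeries_div_hasSum_exp (1 / 2 : ℝ)
    rw [← Real.exp_eq_exp_ℝ] at h
    convert! h using 2 with j
    have h1 := Nat.factorial_mul_descFactorial (Nat.le_add_left k j)
    rw [Nat.add_sub_cancel] at h1
    have h2 : ((j + k).factorial : ℝ) = j.factorial * (j + k).descFactorial k := by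
      exact_mod_cast h1.symm
    have h3 : ((j + k).factorial : ℝ) ≠ 0 := by positivity
    have h4 : ((j + k).descFactorial k : ℝ) ≠ 0 := fun h0 => h3 (by rw [h2, h0, mul_zero])
    have h5 : (2 : ℝ) ^ k * (1 / 2) ^ k = 1 := by rw [← mul_pow]; norm_num
    rw [h2, pow_add]
    have h6 : (j.factorial : ℝ) ≠ 0 := by positivity
    rw [div_eq_div_iff (by positivity) h6]
    linear_combination ((1 / 2 : ℝ) ^ j * (j + k).descFactorial k * j.factorial) * h5
  · intro i hi
    simp [Nat.descFactorial_of_lt (Finset.mem_range.1 hi)]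

theorem hasSum_dobinskiTerm (n : ℕ) :
    HasSum (dobinskiTerm n) (Fintype.card (BPartitionNoZero n) * Real.exp (1 / 2)) := by
  have h := hasSum_sum (s := (Finset.univ : Finset (BPartitionNoZero n)))
    fun π _ => hasSum_descFactorial (blockPairs π.1).card
  rw [Finset.sum_const, nsmul_eq_mul, Finset.card_univ] at h
  convert! h using 2 with j
  rw [dobinskiTerm, two_mul_pow_eq_sum_descFactorial, Finset.sum_mul, Finset.sum_div]

/-! ### The variance through ratios of cardinalities. -/

section moments

variable (n : ℕ)

theorem card_bPartitionNoZero_succ :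
    (Fintype.card (BPartitionNoZero (n + 1)) : ℝ) =
      ∑ π : BPartitionNoZero n, (1 + 2 * ((blockPairs π.1).card : ℝ)) := by
  have := sum_card_blockPairs_succ n fun _ => (1 : ℝ)
  simpa using this

theorem card_bPartitionNoZero_add_two :
    (Fintype.card (BPartitionNoZero (n + 2)) : ℝ) =
      ∑ π : BPartitionNoZero n, (4 * ((blockPairs π.1).card : ℝ) ^ 2 +
        4 * (blockPairs π.1).card + 3) := by
  rw [card_bPartitionNoZero_succ,
    sum_card_blockPairs_succ n fun k => (1 + 2 * (k : ℝ))]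
  refine Finset.sum_congr rfl fun π _ => ?_
  rw [nsmul_eq_mul]
  push_cast
  ring

/-- With k the number of pairs, the ratios are E[4k^2 + 4k + 3] and E[1 + 2k]. -/
theorem variance_numBlockPairs :
    4 * variance (numBlockPairs n) (unifBPartitionNoZero n) + 2 =
      Fintype.card (BPartitionNoZero (n + 2)) / Fintype.card (BPartitionNoZero n) -
        (Fintype.card (BPartitionNoZero (n + 1)) / Fintype.card (BPartitionNoZero n) : ℝ) ^ 2 := by
  have hA : (Fintype.card (BPartitionNoZero n) : ℝ) ≠ 0 := by
    exact_mod_cast Fintype.card_ne_zero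
  rw [variance_eq_sub (MemLp.of_discrete), integral_unifBPartitionNoZero,
    integral_unifBPartitionNoZero, card_bPartitionNoZero_add_two, card_bPartitionNoZero_succ]
  simp only [numBlockPairs, Pi.pow_apply, Finset.sum_add_distrib, ← Finset.mul_sum,
    Finset.sum_const, Finset.card_univ, smul_eq_mul, nsmul_eq_mul]
  field_simp
  ring

end moments

/-! ### No Dobiński term dominates. -/

/-- The ratio of consecutive terms is (1+1/j)^n / (2(j+1)), and (1+1/j)^n ≥ e^(n/(j+1)) ≥
(n/(j+1))^3 / 6; the cubic term of the exponential suffices. -/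
theorem mul_dobinskiTerm_le_succ {n j K : ℕ} (hj : 1 ≤ j) (h : 12 * K * (j + 1) ^ 4 ≤ n ^ 3) :
    K * dobinskiTerm n j ≤ dobinskiTerm n (j + 1) := by
  have hj' : (0 : ℝ) < j + 1 := by positivity
  have h1 : (2 * K * (j + 1) : ℝ) ≤ Real.exp (n / (j + 1)) := by
    refine le_trans ?_ (Real.pow_div_factorial_le_exp (n / (j + 1)) (by positivity) 3)
    have h' : (12 * K * (j + 1) ^ 4 : ℝ) ≤ n ^ 3 := by exact_mod_cast h
    rw [div_pow, div_div, le_div_iff₀ (by positivity)]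
    simp only [Nat.factorial]
    push_cast
    nlinarith
  have h2 : (j : ℝ) ^ n * Real.exp (n / (j + 1)) ≤ (j + 1) ^ n := by
    have h3 : (j : ℝ) / (j + 1) ≤ Real.exp (-(1 / (j + 1))) := by
      have := Real.add_one_le_exp (-(1 / (j + 1)) : ℝ)
      refine le_trans (le_of_eq ?_) this
      field_simp
      ring
    have h4 : (j : ℝ) * Real.exp (1 / (j + 1)) ≤ j + 1 := by
      rw [Real.exp_neg, div_le_iff₀ hj', ← div_eq_inv_mul, le_div_iff₀ (Real.exp_pos _)] at h3
      exact h3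
    have h5 : Real.exp ((n : ℝ) / (j + 1)) = Real.exp (1 / (j + 1)) ^ n := by
      rw [← Real.exp_nat_mul]; congr 1; ring
    rw [h5, ← mul_pow]
    exact pow_le_pow_left₀ (by positivity) h4 n
  have h6 : (j : ℝ) ^ n * (2 * K * (j + 1)) ≤ (j + 1) ^ n :=
    (mul_le_mul_of_nonneg_left h1 (by positivity)).trans h2
  have e1 : dobinskiTerm n (j + 1) =
      (2 ^ n * (1 / 2) ^ (j + 1) / (j + 1).factorial) * (j + 1) ^ n := by
    rw [dobinskiTerm, mul_pow]; push_cast; ring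
  have e2 : K * dobinskiTerm n j =
      (2 ^ n * (1 / 2) ^ (j + 1) / (j + 1).factorial) * ((j : ℝ) ^ n * (2 * K * (j + 1))) := by
    rw [dobinskiTerm, mul_pow, Nat.factorial_succ, pow_succ (1 / 2 : ℝ) j]
    push_cast
    field_simp
  rw [e1, e2]
  exact mul_le_mul_of_nonneg_left h6 (by positivity)

/-- Log-convexity of the factorial is reversed up to a factor 2 on short ranges: the loss is at most
((a+2i)/(a+1))^i, controlled by Bernoulli's inequality. -/
theorem factorial_mul_factorial_le {a i : ℕ} (h : 4 * i ^ 2 ≤ a + 2 * i) :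
    ((a + 2 * i).factorial * a.factorial : ℝ) ≤ 2 * (a + i).factorial ^ 2 := by
  rcases Nat.eq_zero_or_pos i with rfl | hi
  · have : (0 : ℝ) ≤ a.factorial ^ 2 := by positivity
    simp only [mul_zero, add_zero]
    nlinarith
  have h1 : ((a + 2 * i).factorial : ℝ) ≤ (a + i).factorial * (a + 2 * i) ^ i := by
    have := Nat.factorial_mul_ascFactorial (a + i) i
    have h2 := Nat.ascFactorial_le_pow_add (a + i) i
    have e : a + 2 * i = a + i + i := by ring
    rw [e, ← this]
    have : ((a + i).factorial * (a + i + 1).ascFactorial i : ℕ) ≤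
      (a + i).factorial * (a + i + i) ^ i := Nat.mul_le_mul_left _ h2
    have h3 : (((a + i).factorial * (a + i + 1).ascFactorial i : ℕ) : ℝ) ≤
      (((a + i).factorial * (a + i + i) ^ i : ℕ) : ℝ) := by exact_mod_cast this
    refine h3.trans (le_of_eq ?_)
    push_cast
    ring
  have h2 : (a.factorial * (a + 1) ^ i : ℝ) ≤ (a + i).factorial := by
    exact_mod_cast Nat.factorial_mul_pow_le_factorial
  have h3 : ((a + 2 * i) ^ i : ℝ) ≤ 2 * (a + 1) ^ i := by
    have hpos : (0 : ℝ) < a + 2 * i := by positivity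
    have hx : (-2 : ℝ) ≤ -(2 * i / (a + 2 * i)) := by
      have : (2 * i / (a + 2 * i) : ℝ) ≤ 1 := by
        rw [div_le_one hpos]; linarith [(Nat.cast_nonneg a : (0 : ℝ) ≤ a)]
      linarith
    have hb := one_add_mul_le_pow hx i
    have hh : (1 / 2 : ℝ) ≤ 1 + i * -(2 * i / (a + 2 * i)) := by
      have : (i * (2 * i / (a + 2 * i)) : ℝ) ≤ 1 / 2 := by
        rw [← mul_div_assoc, div_le_iff₀ hpos]
        have : (4 * i ^ 2 : ℝ) ≤ a + 2 * i := by exact_mod_cast h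
        nlinarith
      linarith
    have hc : (1 + -(2 * i / (a + 2 * i)) : ℝ) = a / (a + 2 * i) := by
      field_simp
      ring
    rw [hc, div_pow] at hb
    have hd := hh.trans hb
    rw [le_div_iff₀ (by positivity)] at hd
    have : (a : ℝ) ^ i ≤ (a + 1) ^ i := pow_le_pow_left₀ (by positivity) (by linarith) i
    linarith
  calc ((a + 2 * i).factorial * a.factorial : ℝ)
      ≤ (a + i).factorial * (a + 2 * i) ^ i * a.factorial := by gcongr
    _ ≤ (a + i).factorial * (2 * (a + 1) ^ i) * a.factorial := by gcongr
    _ = 2 * (a + i).factorial * (a.factorial * (a + 1) ^ i) := by ring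
    _ ≤ 2 * (a + i).factorial * (a + i).factorial := by gcongr
    _ = _ := by ring

/-- Since (a+2i)a = (a+i)^2 - i^2, Bernoulli's inequality bounds (1 - i^2/(a+i)^2)^n below by 1/2.
-/
theorem sq_pow_le_mul_pow {n a i : ℕ} (h : 2 * n * i ^ 2 ≤ (a + i) ^ 2) :
    (((a + i) ^ 2 : ℝ)) ^ n ≤ 2 * ((a + 2 * i) * a : ℝ) ^ n := by
  rcases Nat.eq_zero_or_pos i with rfl | hi
  · have : (0 : ℝ) ≤ ((a : ℝ) ^ 2) ^ n := by positivity
    have e : ((a + 2 * (0 : ℕ)) * a : ℝ) = a ^ 2 := by push_cast; ring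
    rw [e]
    simp only [Nat.cast_zero, add_zero]
    linarith
  have hpos : (0 : ℝ) < (a + i) ^ 2 := by positivity
  have hx : (-2 : ℝ) ≤ -(i ^ 2 / (a + i) ^ 2) := by
    have : (i ^ 2 / (a + i) ^ 2 : ℝ) ≤ 1 := by
      rw [div_le_one hpos]
      exact pow_le_pow_left₀ (by positivity) (by linarith [(Nat.cast_nonneg a : (0 : ℝ) ≤ a)]) 2
    linarith
  have hb := one_add_mul_le_pow hx n
  have hh : (1 / 2 : ℝ) ≤ 1 + n * -(i ^ 2 / (a + i) ^ 2) := by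
    have : (n * (i ^ 2 / (a + i) ^ 2) : ℝ) ≤ 1 / 2 := by
      rw [← mul_div_assoc, div_le_iff₀ hpos]
      have : (2 * n * i ^ 2 : ℝ) ≤ (a + i) ^ 2 := by exact_mod_cast h
      nlinarith
    linarith
  have hc : (1 + -(i ^ 2 / (a + i) ^ 2) : ℝ) = ((a + 2 * i) * a) / (a + i) ^ 2 := by
    field_simp
    ring
  rw [hc, div_pow] at hb
  have hd := hh.trans hb
  rw [le_div_iff₀ (by positivity)] at hd
  linarith

/-- The two factors 2 give t_{a+i}^2 ≤ 4 t_{a+2i} t_a, and AM-GM turns this into a bound by the sum.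
-/
theorem dobinskiTerm_le_add {n a i : ℕ} (h1 : 4 * i ^ 2 ≤ a + 2 * i)
    (h2 : 2 * n * i ^ 2 ≤ (a + i) ^ 2) :
    dobinskiTerm n (a + i) ≤ dobinskiTerm n (a + 2 * i) + dobinskiTerm n a := by
  have hf := factorial_mul_factorial_le h1
  have hp := sq_pow_le_mul_pow h2
  have key : dobinskiTerm n (a + i) ^ 2 ≤ 4 * (dobinskiTerm n (a + 2 * i) * dobinskiTerm n a) := by
    have e1 : dobinskiTerm n (a + i) ^ 2 = (2 ^ (2 * n) * (1 / 2) ^ (2 * (a + i))) *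
        (((a + i) ^ 2 : ℝ) ^ n / (a + i).factorial ^ 2) := by
      have e : ((a + i) ^ 2 : ℝ) ^ n = ((a + i) ^ n) ^ 2 := by rw [← pow_mul, ← pow_mul, mul_comm]
      rw [dobinskiTerm, e]
      push_cast
      rw [div_pow, mul_pow, mul_pow, mul_pow]
      ring
    have e2 : dobinskiTerm n (a + 2 * i) * dobinskiTerm n a =
        (2 ^ (2 * n) * (1 / 2) ^ (2 * (a + i))) *
        (((a + 2 * i) * a : ℝ) ^ n / ((a + 2 * i).factorial * a.factorial)) := by
      rw [dobinskiTerm, dobinskiTerm]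
      push_cast
      rw [mul_pow, mul_pow, mul_pow]
      field_simp
      ring
    rw [e1, e2, mul_left_comm]
    refine mul_le_mul_of_nonneg_left ?_ (by positivity)
    rw [← mul_div_assoc, div_le_div_iff₀ (by positivity) (by positivity)]
    calc (((a + i) ^ 2 : ℝ)) ^ n * ((a + 2 * i).factorial * a.factorial)
        ≤ (2 * ((a + 2 * i) * a : ℝ) ^ n) * (2 * (a + i).factorial ^ 2) := by gcongr
      _ = _ := by ring
  have n1 := dobinskiTerm_nonneg n (a + 2 * i)
  have n2 := dobinskiTerm_nonneg n a
  refine le_of_sq_le_sq ?_ (by positivity)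
  nlinarith [sq_nonneg (dobinskiTerm n (a + 2 * i) - dobinskiTerm n a)]

/-- No term of the Dobiński series dominates the series. -/
theorem mul_dobinskiTerm_le {n K : ℕ} (hK : 1 ≤ K) (hn : 3072 * K ^ 5 ≤ n) {M : ℝ}
    (hM : HasSum (dobinskiTerm n) M) (j : ℕ) : K * dobinskiTerm n j ≤ 2 * M := by
  have hM0 : 0 ≤ M := hM.nonneg (dobinskiTerm_nonneg n)
  have hn1 : 1 ≤ n := le_trans (by nlinarith [Nat.one_le_pow 5 K hK]) hn
  have hle : ∀ s : Finset ℕ, ∑ i ∈ s, dobinskiTerm n i ≤ M := fun s =>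
    sum_le_hasSum s (fun i _ => dobinskiTerm_nonneg n i) hM
  rcases Nat.eq_zero_or_pos j with rfl | hj
  · have : dobinskiTerm n 0 = 0 := by
      rw [dobinskiTerm]; simp [show n ≠ 0 by omega]
    rw [this]; linarith
  -- Below 2K√n the next term is already K times larger. Beyond it, t_j ≤ t_{j+i} + t_{j-i} for 1 ≤
  -- i ≤ K, and summing over i bounds K t_j by two partial sums.
  rcases lt_or_ge (j ^ 2) (4 * n * K ^ 2) with h | h
  · refine (mul_dobinskiTerm_le_succ hj ?_).trans ?_
    · have h1 : (j + 1) ^ 4 ≤ 256 * n ^ 2 * K ^ 4 := by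
        calc (j + 1) ^ 4 ≤ (2 * j) ^ 4 := Nat.pow_le_pow_left (by omega) 4
          _ = 16 * (j ^ 2) ^ 2 := by ring
          _ ≤ 16 * (4 * n * K ^ 2) ^ 2 := by gcongr
          _ = _ := by ring
      calc 12 * K * (j + 1) ^ 4 ≤ 12 * K * (256 * n ^ 2 * K ^ 4) := by gcongr
        _ = (3072 * K ^ 5) * n ^ 2 := by ring
        _ ≤ n * n ^ 2 := by gcongr
        _ = n ^ 3 := by ring
    · have := hle {j + 1}
      rw [Finset.sum_singleton] at this
      linarith
  · have hKj : 4 * K ^ 2 ≤ j := by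
      refine (Nat.pow_le_pow_iff_left two_ne_zero).1 (le_trans ?_ h)
      have : 4 * K ^ 2 ≤ n := by
        refine le_trans ?_ hn
        have : K ^ 2 ≤ K ^ 5 := Nat.pow_le_pow_right hK (by norm_num)
        omega
      calc (4 * K ^ 2) ^ 2 = 4 * (4 * K ^ 2) * K ^ 2 := by ring
        _ ≤ 4 * n * K ^ 2 := by gcongr
    have hKj' : K ≤ j := le_trans (by nlinarith) hKj
    have h1 : ∀ i ∈ Finset.Icc 1 K,
        dobinskiTerm n j ≤ dobinskiTerm n (j + i) + dobinskiTerm n (j - i) := by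
      intro i hi
      rw [Finset.mem_Icc] at hi
      have hi2 : i ^ 2 ≤ K ^ 2 := Nat.pow_le_pow_left hi.2 2
      obtain ⟨a, rfl⟩ := Nat.exists_eq_add_of_le (hi.2.trans hKj')
      have := dobinskiTerm_le_add (n := n) (a := a) (i := i) (by omega) (by
        rw [add_comm a i]
        refine le_trans ?_ h
        calc 2 * n * i ^ 2 ≤ 4 * n * K ^ 2 := by gcongr; norm_num)
      rw [Nat.add_sub_cancel_left, show i + a + i = a + 2 * i by ring, add_comm i a]
      exact this
    have h2 := Finset.sum_le_sum h1
    rw [Finset.sum_const, Nat.card_Icc, Nat.add_sub_cancel, nsmul_eq_mul,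
      Finset.sum_add_distrib] at h2
    have h3 : ∑ i ∈ Finset.Icc 1 K, dobinskiTerm n (j + i) ≤ M := by
      rw [← Finset.sum_image (f := dobinskiTerm n) (g := fun i => j + i)
        (fun a _ b _ h => by simpa using h)]
      exact hle _
    have h4 : ∑ i ∈ Finset.Icc 1 K, dobinskiTerm n (j - i) ≤ M := by
      rw [← Finset.sum_image (f := dobinskiTerm n) (g := fun i => j - i)
        (fun a ha b hb h => by
          simp only [Finset.coe_Icc, Set.mem_Icc] at ha hb
          simp only at h
          omega)]
      exact hle _
    linarith

/-! ### The variance tends to infinity. -/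

/-- With K = 4(2L+1), a window of 2L+1 indices around the mean has at most half of the mass; the
rest lies at distance at least L from the mean of 2J. -/
theorem le_variance_numBlockPairs {n L : ℕ} (hn : 3072 * (4 * (2 * L + 1)) ^ 5 ≤ n) :
    (L : ℝ) ^ 2 / 2 ≤ 4 * variance (numBlockPairs n) (unifBPartitionNoZero n) + 2 := by
  rw [variance_numBlockPairs]
  have hA : (0 : ℝ) < Fintype.card (BPartitionNoZero n) := by exact_mod_cast Fintype.card_pos
  have he := Real.exp_pos (1 / 2)
  have H0 := hasSum_dobinskiTerm n
  have H1 := hasSum_dobinskiTerm (n + 1)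
  have H2 := hasSum_dobinskiTerm (n + 2)
  have hmax := mul_dobinskiTerm_le (by omega) hn H0
  set A0 : ℝ := ((Fintype.card (BPartitionNoZero n) : ℕ) : ℝ)
  set A1 : ℝ := ((Fintype.card (BPartitionNoZero (n + 1)) : ℕ) : ℝ)
  set A2 : ℝ := ((Fintype.card (BPartitionNoZero (n + 2)) : ℕ) : ℝ)
  set c := A1 / A0 with hc
  have hc0 : 0 ≤ c := by positivity
  -- Here c is the mean of 2J, so the window is centered near the mean of J.
  set j₀ := ⌊c / 2⌋₊ with hj₀
  have hj1 : (j₀ : ℝ) ≤ c / 2 := Nat.floor_le (by positivity)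
  have hj2 : c / 2 < j₀ + 1 := Nat.lt_floor_add_one _
  set W := Finset.Icc (j₀ - L) (j₀ + L) with hW
  have hWcard : (W.card : ℝ) ≤ 2 * L + 1 := by
    have : W.card ≤ 2 * L + 1 := by rw [hW, Nat.card_Icc]; omega
    exact_mod_cast this
  have hWsum : ∑ j ∈ W, dobinskiTerm n j ≤ A0 * Real.exp (1 / 2) / 2 := by
    have h1 : ∀ j ∈ W, dobinskiTerm n j ≤ A0 * Real.exp (1 / 2) / (2 * (2 * L + 1)) := by
      intro j _
      have := hmax j
      push_cast at this
      rw [le_div_iff₀ (by positivity)]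
      linarith
    refine (Finset.sum_le_sum h1).trans ?_
    rw [Finset.sum_const, nsmul_eq_mul]
    calc (W.card : ℝ) * (A0 * Real.exp (1 / 2) / (2 * (2 * L + 1)))
        ≤ (2 * L + 1) * (A0 * Real.exp (1 / 2) / (2 * (2 * L + 1))) := by gcongr
      _ = _ := by field_simp
  -- Multiplying a term by 2j raises n by one, so expanding the square gives A2 - 2c A1 + c^2 A0
  -- with c = A1/A0.
  have hsum : HasSum (fun j : ℕ => (2 * j - c) ^ 2 * dobinskiTerm n j)
      ((A2 - A1 ^ 2 / A0) * Real.exp (1 / 2)) := by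
    convert! (H2.sub (H1.mul_left (2 * c))).add (H0.mul_left (c ^ 2)) using 1
    · ext j
      rw [dobinskiTerm_succ (n + 1), dobinskiTerm_succ n]
      ring
    · rw [hc]; field_simp; ring
  have hind : HasSum (fun j => if j ∈ W then dobinskiTerm n j else 0)
      (∑ j ∈ W, dobinskiTerm n j) := by
    have := hasSum_sum_of_ne_finset_zero (s := W) (L := .unconditional ℕ)
      (f := fun j => if j ∈ W then dobinskiTerm n j else 0) (fun b hb => if_neg hb)
    rwa [Finset.sum_congr rfl fun j hj => if_pos hj] at this
  have hle := hasSum_le (fun j => ?_) ((H0.sub hind).mul_left ((L : ℝ) ^ 2)) hsum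
  · have h3 : (L : ℝ) ^ 2 * (A0 * Real.exp (1 / 2) / 2) ≤
        (A2 - A1 ^ 2 / A0) * Real.exp (1 / 2) := by
      refine le_trans (mul_le_mul_of_nonneg_left ?_ (by positivity)) hle
      linarith
    have h4 : (L : ℝ) ^ 2 / 2 * A0 ≤ A2 - A1 ^ 2 / A0 := by
      refine le_of_mul_le_mul_right ?_ he
      linarith
    have h5 : A2 / A0 - c ^ 2 = (A2 - A1 ^ 2 / A0) / A0 := by
      rw [hc]; field_simp
    rw [h5, le_div_iff₀ hA]
    exact h4
  · have hv := dobinskiTerm_nonneg n j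
    by_cases hj : j ∈ W
    · simp only [hj, if_true, sub_self, mul_zero]
      positivity
    · simp only [hj, if_false, sub_zero]
      refine mul_le_mul_of_nonneg_right ?_ hv
      have hL : (0 : ℝ) ≤ L := Nat.cast_nonneg L
      rw [hW, Finset.mem_Icc, not_and_or, not_le, not_le] at hj
      rw [sq_le_sq, abs_of_nonneg hL]
      rcases hj with hj | hj
      · have : j + L + 1 ≤ j₀ := by omega
        have : (j + L + 1 : ℝ) ≤ j₀ := by exact_mod_cast this
        rw [le_abs]; right; linarith
      · have : j₀ + L + 1 ≤ j := by omega
        have : (j₀ + L + 1 : ℝ) ≤ j := by exact_mod_cast this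
        rw [le_abs]; left; linarith

theorem tendsto_variance_numBlockPairs :
    Tendsto (fun n => variance (numBlockPairs n) (unifBPartitionNoZero n)) atTop atTop := by
  rw [tendsto_atTop]
  intro b
  obtain ⟨L, hL⟩ := exists_nat_ge (8 * |b| + 4)
  filter_upwards [eventually_ge_atTop (3072 * (4 * (2 * L + 1)) ^ 5)] with n hn
  have h := le_variance_numBlockPairs hn
  have h1 := le_abs_self b
  have h2 := abs_nonneg b
  nlinarith

/-! ### Characteristic functions of Bernoulli sums. -/

section bernoulli

open Complex

/-- The characteristic function at `u` of a centered Bernoulli variable of parameter `p`. -/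
noncomputable def bernoulliCharFun (u p : ℝ) : ℂ := (1 - p + p * exp (u * I)) * exp (-(u * p) * I)

theorem bernoulliCharFun_eq (u p : ℝ) :
    bernoulliCharFun u p =
      (1 - p) * exp ((-(u * p) : ℝ) * I) + p * exp ((u * (1 - p) : ℝ) * I) := by
  rw [bernoulliCharFun, add_mul, mul_assoc, ← exp_add]
  push_cast
  ring_nf

theorem norm_bernoulliCharFun_le {u p : ℝ} (h0 : 0 ≤ p) (h1 : p ≤ 1) :
    ‖bernoulliCharFun u p‖ ≤ 1 := by
  rw [bernoulliCharFun_eq]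
  refine (norm_add_le _ _).trans ?_
  rw [norm_mul, norm_mul, norm_exp_ofReal_mul_I, norm_exp_ofReal_mul_I]
  have e : ‖(1 - p : ℂ)‖ = 1 - p := by
    rw [← ofReal_one, ← ofReal_sub, norm_real, Real.norm_of_nonneg (by linarith)]
  rw [e, norm_real, Real.norm_of_nonneg h0]
  linarith

theorem norm_exp_mul_I_sub_le {x : ℝ} (hx : |x| ≤ 1) :
    ‖exp (x * I) - (1 + x * I - x ^ 2 / 2)‖ ≤ 2 / 9 * |x| ^ 3 := by
  have hn : ‖(x * I : ℂ)‖ = |x| := by simp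
  have h := exp_bound (x := x * I) (by rwa [hn]) (n := 3) (by norm_num)
  rw [hn] at h
  have e : ∑ m ∈ Finset.range 3, (x * I : ℂ) ^ m / m.factorial = 1 + x * I - x ^ 2 / 2 := by
    simp [Finset.sum_range_succ, mul_pow, Nat.factorial]
    ring
  rw [e] at h
  refine h.trans (le_of_eq ?_)
  norm_num [Nat.factorial]
  ring

/-- Both sides agree to second order in u: the mean is 0 and the variance p(1-p). Keeping the factor
p(1-p) in the error is essential, since it makes the errors sum to a multiple of the variance. The
constant comes from 2/9 + 2/9 + 1 ≤ 2. -/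
theorem norm_bernoulliCharFun_sub_le {u p : ℝ} (h0 : 0 ≤ p) (h1 : p ≤ 1) (hu : |u| ≤ 1) :
    ‖bernoulliCharFun u p - exp ((-(p * (1 - p) * u ^ 2 / 2) : ℝ))‖ ≤
      2 * |u| ^ 3 * (p * (1 - p)) := by
  have hq : 0 ≤ 1 - p := by linarith
  have hpq : 0 ≤ p * (1 - p) := mul_nonneg h0 hq
  have hpq1 : p * (1 - p) ≤ 1 := by nlinarith
  have hu0 := abs_nonneg u
  have a1 : |-(u * p)| = |u| * p := by rw [abs_neg, abs_mul, abs_of_nonneg h0]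
  have a2 : |u * (1 - p)| = |u| * (1 - p) := by rw [abs_mul, abs_of_nonneg hq]
  have b1 := norm_exp_mul_I_sub_le (x := -(u * p)) (by rw [a1]; nlinarith)
  have b2 := norm_exp_mul_I_sub_le (x := u * (1 - p)) (by rw [a2]; nlinarith)
  rw [a1] at b1
  rw [a2] at b2
  set y := p * (1 - p) * u ^ 2 / 2 with hy
  have hu2 : u ^ 2 ≤ 1 := by rw [← sq_abs]; nlinarith
  have hy0 : 0 ≤ y := by positivity
  have hy1 : y ≤ 1 := by rw [hy]; nlinarith [sq_nonneg u]
  have b3 : ‖exp ((-y : ℝ)) - 1 - ((-y : ℝ) : ℂ)‖ ≤ y ^ 2 := by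
    have hn : ‖((-y : ℝ) : ℂ)‖ = y := by
      rw [norm_real, Real.norm_eq_abs, abs_neg, abs_of_nonneg hy0]
    have := norm_exp_sub_one_sub_id_le (x := ((-y : ℝ) : ℂ)) (by rwa [hn])
    rwa [hn] at this
  set E1 := exp ((-(u * p) : ℝ) * I) - (1 + (-(u * p) : ℝ) * I - (-(u * p) : ℝ) ^ 2 / 2) with hE1
  set E2 := exp ((u * (1 - p) : ℝ) * I) -
    (1 + (u * (1 - p) : ℝ) * I - (u * (1 - p) : ℝ) ^ 2 / 2) with hE2
  set E3 := exp ((-y : ℝ)) - 1 - ((-y : ℝ) : ℂ) with hE3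
  have e : bernoulliCharFun u p - exp ((-y : ℝ)) =
      ((1 - p : ℝ) : ℂ) * E1 + (p : ℂ) * E2 - E3 := by
    rw [bernoulliCharFun_eq, hE1, hE2, hE3, hy]
    push_cast
    ring
  rw [e]
  have c1 : ‖((1 - p : ℝ) : ℂ) * E1‖ ≤ (1 - p) * (2 / 9 * (|u| * p) ^ 3) := by
    rw [norm_mul, norm_real, Real.norm_of_nonneg hq]
    exact mul_le_mul_of_nonneg_left b1 hq
  have c2 : ‖(p : ℂ) * E2‖ ≤ p * (2 / 9 * (|u| * (1 - p)) ^ 3) := by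
    rw [norm_mul, norm_real, Real.norm_of_nonneg h0]
    exact mul_le_mul_of_nonneg_left b2 h0
  have d1 : (1 - p) * (2 / 9 * (|u| * p) ^ 3) ≤ 2 / 9 * |u| ^ 3 * (p * (1 - p)) := by
    have hp2 : p ^ 2 ≤ 1 := by nlinarith
    calc (1 - p) * (2 / 9 * (|u| * p) ^ 3) = 2 / 9 * |u| ^ 3 * (p * (1 - p)) * p ^ 2 := by ring
      _ ≤ 2 / 9 * |u| ^ 3 * (p * (1 - p)) * 1 := by gcongr
      _ = _ := by ring
  have d2 : p * (2 / 9 * (|u| * (1 - p)) ^ 3) ≤ 2 / 9 * |u| ^ 3 * (p * (1 - p)) := by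
    have hp2 : (1 - p) ^ 2 ≤ 1 := by nlinarith
    calc p * (2 / 9 * (|u| * (1 - p)) ^ 3) = 2 / 9 * |u| ^ 3 * (p * (1 - p)) * (1 - p) ^ 2 := by
          ring
      _ ≤ 2 / 9 * |u| ^ 3 * (p * (1 - p)) * 1 := by gcongr
      _ = _ := by ring
  have d3 : y ^ 2 ≤ |u| ^ 3 * (p * (1 - p)) := by
    have : y ^ 2 = |u| ^ 3 * (p * (1 - p)) * (|u| * (p * (1 - p)) / 4) := by
      rw [hy, ← sq_abs u]; ring
    rw [this]
    have h4 : |u| * (p * (1 - p)) / 4 ≤ 1 := by nlinarith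
    have h5 : 0 ≤ |u| ^ 3 * (p * (1 - p)) := by positivity
    nlinarith
  have h5 : 0 ≤ |u| ^ 3 * (p * (1 - p)) := by positivity
  calc ‖((1 - p : ℝ) : ℂ) * E1 + (p : ℂ) * E2 - E3‖
      ≤ ‖((1 - p : ℝ) : ℂ) * E1‖ + ‖(p : ℂ) * E2‖ + ‖E3‖ :=
        (norm_sub_le _ _).trans (add_le_add_left (norm_add_le _ _) _)
    _ ≤ 2 * |u| ^ 3 * (p * (1 - p)) := by linarith

theorem norm_prod_bernoulliCharFun_sub_le {u : ℝ} (hu : |u| ≤ 1) (s : Multiset ℝ)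
    (hs : ∀ p ∈ s, 0 ≤ p ∧ p ≤ 1) :
    ‖(s.map (bernoulliCharFun u)).prod -
        exp ((-((s.map fun p => p * (1 - p)).sum * u ^ 2 / 2) : ℝ))‖ ≤
      2 * |u| ^ 3 * (s.map fun p => p * (1 - p)).sum := by
  -- Nonnegativity of the variance is carried through the induction to keep the Gaussian factor at
  -- norm at most 1.
  suffices h : 0 ≤ (s.map fun p => p * (1 - p)).sum ∧
      ‖(s.map (bernoulliCharFun u)).prod -
        exp ((-((s.map fun p => p * (1 - p)).sum * u ^ 2 / 2) : ℝ))‖ ≤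
      2 * |u| ^ 3 * (s.map fun p => p * (1 - p)).sum from h.2
  induction s using Multiset.induction_on with
  | empty => simp
  | cons p s ih =>
    obtain ⟨hnn, ih⟩ := ih fun p hp => hs p (Multiset.mem_cons_of_mem hp)
    obtain ⟨h0, h1⟩ := hs p (Multiset.mem_cons_self p s)
    have hp := norm_bernoulliCharFun_sub_le h0 h1 hu
    have hb := norm_bernoulliCharFun_le (u := u) h0 h1
    simp only [Multiset.map_cons, Multiset.prod_cons, Multiset.sum_cons]
    set V := (s.map fun p => p * (1 - p)).sum
    set P := (s.map (bernoulliCharFun u)).prod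
    have hpq : 0 ≤ p * (1 - p) := mul_nonneg h0 (by linarith)
    refine ⟨by positivity, ?_⟩
    have e : exp ((-((p * (1 - p) + V) * u ^ 2 / 2) : ℝ)) =
        exp ((-(p * (1 - p) * u ^ 2 / 2) : ℝ)) * exp ((-(V * u ^ 2 / 2) : ℝ)) := by
      rw [← exp_add]
      congr 1
      push_cast
      ring
    have hE : ‖exp ((-(V * u ^ 2 / 2) : ℝ))‖ ≤ 1 := by
      rw [norm_exp_ofReal, Real.exp_le_one_iff, neg_nonpos]
      positivity
    rw [e]
    set b := bernoulliCharFun u p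
    set x := exp ((-(p * (1 - p) * u ^ 2 / 2) : ℝ))
    set y := exp ((-(V * u ^ 2 / 2) : ℝ))
    -- Telescoping: all factors have norm at most 1, so the errors just add.
    calc ‖b * P - x * y‖ = ‖b * (P - y) + (b - x) * y‖ := by ring_nf
      _ ≤ ‖b‖ * ‖P - y‖ + ‖b - x‖ * ‖y‖ := by
        rw [← norm_mul, ← norm_mul]; exact norm_add_le _ _
      _ ≤ 1 * ‖P - y‖ + ‖b - x‖ * 1 := by gcongr
      _ ≤ 2 * |u| ^ 3 * (p * (1 - p) + V) := by linarith

end bernoulli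

/-! ### The normal limit. -/

theorem charFun_normalized_numBlockPairs (n : ℕ) {s : Multiset ℝ}
    (hs : ∀ z : ℂ, ∑ π : BPartitionNoZero n, z ^ (blockPairs π.1).card =
      Fintype.card (BPartitionNoZero n) * (s.map fun p : ℝ => 1 - (p : ℂ) + p * z).prod)
    (σ t : ℝ) :
    charFun ((unifBPartitionNoZero n).map fun π => (numBlockPairs n π - s.sum) / σ) t =
      (s.map (bernoulliCharFun (t / σ))).prod := by
  have hA : (Fintype.card (BPartitionNoZero n) : ℂ) ≠ 0 := by
    exact_mod_cast Fintype.card_ne_zero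
  rw [charFun_apply_real, integral_map (Measurable.of_discrete).aemeasurable
    (by fun_prop), integral_unifBPartitionNoZero]
  have h1 : ∀ π : BPartitionNoZero n,
      Complex.exp (t * ((numBlockPairs n π - s.sum) / σ : ℝ) * Complex.I) =
        Complex.exp ((t / σ : ℝ) * Complex.I) ^ (blockPairs π.1).card *
          Complex.exp (-((t / σ : ℝ) * (s.sum : ℝ)) * Complex.I) := by
    intro π
    rw [← Complex.exp_nat_mul, ← Complex.exp_add, numBlockPairs]
    congr 1
    push_cast
    ring
  have h2 : Complex.exp (-((t / σ : ℝ) * (s.sum : ℝ)) * Complex.I) =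
      (s.map fun p : ℝ => Complex.exp (-((t / σ : ℝ) * p) * Complex.I)).prod := by
    clear hs h1
    induction s using Multiset.induction_on with
    | empty => simp
    | cons p s ih =>
      rw [Multiset.map_cons, Multiset.prod_cons, ← ih, Multiset.sum_cons, ← Complex.exp_add]
      congr 1
      push_cast
      ring
  simp_rw [h1]
  rw [← Finset.sum_mul, hs, h2, mul_assoc, ← Multiset.prod_map_mul, Complex.real_smul]
  rw [Complex.ofReal_inv, Complex.ofReal_natCast, inv_mul_cancel_left₀ hA]
  rfl

theorem mainTheorem5 :
    TendstoInDistribution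
      (fun (n : ℕ) (π : BPartitionNoZero n) =>
        (numBlockPairs n π - ∫ ρ, numBlockPairs n ρ ∂(unifBPartitionNoZero n)) /
          √(variance (numBlockPairs n) (unifBPartitionNoZero n)))
      atTop (id : ℝ → ℝ) (fun n => unifBPartitionNoZero n) (gaussianReal 0 1) := by
  refine ⟨fun n => (Measurable.of_discrete).aemeasurable, aemeasurable_id, ?_⟩
  refine ProbabilityMeasure.tendsto_iff_tendsto_charFun.2 fun t => ?_
  choose s hs hgen hmean hvar using exists_bernoulli_numBlockPairs
  simp only [ProbabilityMeasure.coe_mk, Measure.map_id, charFun_gaussianReal, hmean,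
    fun n => charFun_normalized_numBlockPairs n (hgen n)]
  set V := fun n => variance (numBlockPairs n) (unifBPartitionNoZero n) with hV
  have hVtop : Tendsto V atTop atTop := tendsto_variance_numBlockPairs
  have hsq : Tendsto (fun n => √(V n)) atTop atTop := Real.tendsto_sqrt_atTop.comp hVtop
  rw [tendsto_iff_norm_sub_tendsto_zero]
  have hlim : Tendsto (fun n => 2 * |t| ^ 3 / √(V n)) atTop (nhds 0) :=
    tendsto_const_nhds.div_atTop hsq
  refine squeeze_zero' (Eventually.of_forall fun _ => norm_nonneg _) ?_ hlim
  -- √V ≥ |t| gives |t/√V| ≤ 1, as the Taylor estimate needs; √V ≥ 1 keeps the division genuine.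
  filter_upwards [hsq.eventually_ge_atTop (max 1 |t|)] with n hn
  have hσ1 : 1 ≤ √(V n) := (le_max_left _ _).trans hn
  have hσ : 0 < √(V n) := by linarith
  have hVσ : V n = √(V n) ^ 2 := (Real.sq_sqrt (variance_nonneg _ _)).symm
  have hu : |t / √(V n)| ≤ 1 := by
    rw [abs_div, abs_of_pos hσ, div_le_one hσ]
    exact (le_max_right _ _).trans hn
  have h := norm_prod_bernoulliCharFun_sub_le hu (s n) (hs n)
  rw [← hvar n] at h
  change ‖_ - Complex.exp ((-(V n * _ / 2) : ℝ))‖ ≤ _ * V n at h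
  have e1 : V n * (t / √(V n)) ^ 2 = t ^ 2 := by
    rw [div_pow, ← hVσ, mul_div_cancel₀]
    rw [hVσ]; positivity
  have e2 : 2 * |t / √(V n)| ^ 3 * V n = 2 * |t| ^ 3 / √(V n) := by
    rw [abs_div, abs_of_pos hσ, div_pow]
    nth_rewrite 2 [hVσ]
    field_simp
  rw [e1, e2] at h
  have e3 : (t * (0 : ℝ) * Complex.I - ((1 : NNReal) : ℝ) * t ^ 2 / 2 : ℂ) =
      ((-(t ^ 2 / 2) : ℝ) : ℂ) := by
    push_cast
    ring
  rw [e3]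
  exact h
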